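/- **Theorem (conformal invariance of the reduced $f$-divergence distance).** For a bounded simply connected planar domain $\Omega\subset\mathbb C$, a set $E\subseteq\partial\Omega$ and $z\in\Omega$, let $\phi^{\Omega}(E,z)$ be the harmonic measure of $E$ at $z$, i.e. the value at $z$ of the (Perron) solution of the Dirichlet problem on $\Omega$ with boundary function $1_E$: $$\phi^{\Omega}(E,z)=\sup\{v(z) : v \text{ subharmonic on } \Omega,\ \limsup_{w\to\zeta,\,w\in\Omega} v(w)\le 1_E(\zeta)\ \text{for all } \zeta\in\partial\Omega\}.$$ Suppose that $\partial\Omega$ is a simple closed curve, parametrized by a continuous $2\pi$-periodic $\gamma:\mathbb R\to\mathbb C$ that is injective on $[0,2\pi)$ and has image $\partial\Omega$. A partition of $\partial\Omega$ is given by such a $\gamma$ and parameters $t_1<\dots<t_n<t_{n+1}=t_1+2\pi$; its segments are $E_j=\gamma([t_j,t_{j+1}])$, $1\le j\le n$. Let $f:(0,\infty)\to\mathbb R$ be strictly convex with $f(1)=0$. The reduced $f$-divergence distance of $\Omega$ for this partition is $$d_f^{\Omega}(z,y)=\sum_{j=1}^n \phi_j(z)\, f\!\left(\frac{\phi_j(y)}{\phi_j(z)}\right),\qquad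 \phi_j(z)=\phi^{\Omega}(E_j,z),\quad z,y\in\Omega .$$ Let $\Omega_1,\Omega_2$ be two bounded simply connected domains, each bounded by a simple closed curve, and let $C$ be a conformal map (injective and holomorphic) of $\Omega_1$ onto $\Omega_2$ that is continuous on $\overline{\Omega_1}$ and satisfies $C(\partial\Omega_1)=\partial\Omega_2$. Let $(\gamma;t_1,\dots,t_n)$ be a partition of $\partial\Omega_1$ such that $(C\circ\gamma;t_1,\dots,t_n)$ is a partition of $\partial\Omega_2$, and let $d_f^{\Omega_1}$ and $d_f^{\Omega_2}$ be the reduced $f$-divergence distances for these two partitions. Then for all $x,y\in\Omega_1$, $$d_f^{\Omega_2}(C(x),C(y))=d_f^{\Omega_1}(x,y).$$ -/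

import Mathlib

open Set Filter Topology

noncomputable section

namespace ReducedDivergence

/-- A bounded simply connected planar domain. -/
structure IsDomain (Ω : Set ℂ) : Prop where
  isOpen : IsOpen Ω
  isBounded : Bornology.IsBounded Ω
  isSimplyConnected : IsSimplyConnected Ω

/-- Real-valued subharmonic functions on an open set `Ω`: upper semicontinuous functions that lie
below every harmonic function on a compact subset `K` of `Ω` as soon as they do so on the
boundary of `K` (the harmonic function being continuous on `K`). -/
structure IsSubharmonicOn (v : ℂ → ℝ) (Ω : Set ℂ) : Prop where
  upperSemicontinuousOn : UpperSemicontinuousOn v Ω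
  le_harmonic : ∀ K : Set ℂ, K ⊆ Ω → IsCompact K → ∀ h : ℂ → ℝ, ContinuousOn h K →
    InnerProductSpace.HarmonicOnNhd h (interior K) →
    (∀ w ∈ frontier K, v w ≤ h w) → ∀ w ∈ K, v w ≤ h w

/-- The Perron family of the boundary function `1_E`: the subharmonic functions `v` on `Ω` with
`limsup v(w) ≤ 1_E(ζ)`, as `w → ζ` inside `Ω`, for every boundary point `ζ` of `Ω`. -/
def perronFamily (Ω E : Set ℂ) : Set (ℂ → ℝ) :=
  {v | IsSubharmonicOn v Ω ∧
    ∀ ζ ∈ frontier Ω, ∀ ε : ℝ, 0 < ε →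
      ∀ᶠ w in 𝓝[Ω] ζ, v w < E.indicator (fun _ => (1 : ℝ)) ζ + ε}

/-- The harmonic measure of the boundary set `E` of `Ω` seen from `z`: the value at `z` of the
Perron solution of the Dirichlet problem on `Ω` with boundary function `1_E`. -/
def harmonicMeasure (Ω E : Set ℂ) (z : ℂ) : ℝ :=
  sSup ((fun v : ℂ → ℝ => v z) '' perronFamily Ω E)

/-- A partition of the boundary of `Ω` into `n` segments: the boundary is parametrized as a simple
closed curve (of period `2π`), and is cut at the `n` parameters
`t 0 < t 1 < ⋯ < t (n - 1) < t n = t 0 + 2π`. -/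
structure BoundaryPartition (Ω : Set ℂ) (n : ℕ) where
  curve : ℝ → ℂ
  continuous_curve : Continuous curve
  periodic_curve : Function.Periodic curve (2 * Real.pi)
  injOn_curve : InjOn curve (Ico 0 (2 * Real.pi))
  range_curve : range curve = frontier Ω
  t : Fin (n + 1) → ℝ
  strictMono_t : StrictMono t
  t_last : t (Fin.last n) = t 0 + 2 * Real.pi

/-- The `j`-th closed segment `E_j = [t_j, t_{j+1}]` of the boundary. -/
def BoundaryPartition.segment {Ω : Set ℂ} {n : ℕ} (P : BoundaryPartition Ω n) (j : Fin n) :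
    Set ℂ :=
  P.curve '' Icc (P.t j.castSucc) (P.t j.succ)

/-- The reduced coordinates `φ_j(z)` of a point `z` of `Ω`. -/
def reducedCoord {Ω : Set ℂ} {n : ℕ} (P : BoundaryPartition Ω n) (j : Fin n) (z : ℂ) : ℝ :=
  harmonicMeasure Ω (P.segment j) z

/-- The reduced `f`-divergence distance `d_f(z, y) = ∑ⱼ φ_j(z) f(φ_j(y) / φ_j(z))`. -/
def reducedDivergence {Ω : Set ℂ} {n : ℕ} (P : BoundaryPartition Ω n) (f : ℝ → ℝ) (z y : ℂ) : ℝ :=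
  ∑ j : Fin n, reducedCoord P j z * f (reducedCoord P j y / reducedCoord P j z)

/-- `C` is a conformal map of `Ω₁` onto `Ω₂`, defined and continuous up to the boundary and
carrying boundary to boundary. -/
structure IsConformalMap (C : ℂ → ℂ) (Ω₁ Ω₂ : Set ℂ) : Prop where
  differentiableOn : DifferentiableOn ℂ C Ω₁
  injOn : InjOn C Ω₁
  image_eq : C '' Ω₁ = Ω₂
  continuousOn_closure : ContinuousOn C (closure Ω₁)
  image_frontier : C '' frontier Ω₁ = frontier Ω₂

/-- The partition `P₂` of the boundary of `Ω₂` is the partition `P₁` of the boundary of `Ω₁`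
transported by `C`. -/
structure IsTransported (C : ℂ → ℂ) {Ω₁ Ω₂ : Set ℂ} {n : ℕ} (P₁ : BoundaryPartition Ω₁ n)
    (P₂ : BoundaryPartition Ω₂ n) : Prop where
  curve_eq : ∀ s : ℝ, P₂.curve s = C (P₁.curve s)
  t_eq : P₂.t = P₁.t

end ReducedDivergence

end

open InnerProductSpace

namespace ReducedDivergence

/-! The divergence sees points only through their coordinates, so it suffices that harmonic measure
is conformally invariant. Since both boundary curves are injective on a period, `C` is injective on
the boundary, hence on the closure; compactness and removable singularities make it an
`IsBoundaryBiholomorphism`. Composition with `C` and with its inverse then carries the two Perron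
families into each other (`comp_mem_perronFamily`), so the suprema agree. -/

/-- A harmonic function precomposed with a holomorphic one is harmonic. -/
theorem harmonicAt_comp_analyticAt {h : ℂ → ℝ} {g : ℂ → ℂ} {w : ℂ}
    (hh : HarmonicAt h (g w)) (hg : AnalyticAt ℂ g w) : HarmonicAt (h ∘ g) w := by
  obtain ⟨ε, hε, hball⟩ := Metric.isOpen_iff.1 (isOpen_setOfPred_harmonicAt (f := h)) (g w) hh
  -- On a ball `h` is the real part of a holomorphic `F`, and `F ∘ g` is holomorphic.
  obtain ⟨F, hF, hFh⟩ := HarmonicOnNhd.exists_analyticOnNhd_ball_re_eq (fun _ hy ↦ hball hy)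
  have hFg : AnalyticAt ℂ (F ∘ g) w := (hF (g w) (Metric.mem_ball_self hε)).comp hg
  have hre : HarmonicAt (Complex.reCLM ∘ (F ∘ g)) w := hFg.harmonicAt.comp_CLM Complex.reCLM
  refine (harmonicAt_congr_nhds ?_).1 hre
  filter_upwards [hg.continuousAt.preimage_mem_nhds (Metric.ball_mem_nhds (g w) hε)] with z hz
  exact hFh hz

/-- A holomorphic function that is injective near a point has no other critical points nearby. -/
theorem eventually_deriv_ne_zero_of_injOn {g : ℂ → ℂ} {U : Set ℂ} {w : ℂ} (hU : IsOpen U)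
    (hw : w ∈ U) (hg : DifferentiableOn ℂ g U) (hinj : InjOn g U) :
    ∀ᶠ z in 𝓝[≠] w, deriv g z ≠ 0 := by
  have hd : AnalyticAt ℂ (deriv g) w := ((hg.analyticOnNhd hU) w hw).deriv
  refine hd.eventually_eq_zero_or_eventually_ne_zero.resolve_left fun h0 ↦ ?_
  obtain ⟨ε, hε, hball⟩ := Metric.mem_nhds_iff.1 (h0.and (hU.mem_nhds hw))
  have hconst : ∀ z ∈ Metric.ball w ε, g z = g w := fun z hz ↦
    Metric.isOpen_ball.is_const_of_deriv_eq_zero (convex_ball w ε).isPreconnected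
      (hg.mono fun y hy ↦ (hball hy).2) (fun y hy ↦ (hball hy).1) hz (Metric.mem_ball_self hε)
  have hz : w + (ε / 2 : ℝ) ∈ Metric.ball w ε := by
    simp [abs_of_pos hε, hε]
  have := hinj (hball hz).2 hw (hconst _ hz)
  simp [hε.ne'] at this

/-- A continuous inverse of an injective holomorphic function is holomorphic. -/
theorem differentiableOn_of_inverse {g k : ℂ → ℂ} {U V : Set ℂ} (hU : IsOpen U) (hV : IsOpen V)
    (hg : DifferentiableOn ℂ g U) (hinj : InjOn g U) (hk : ContinuousOn k V) (hkV : MapsTo k V U)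
    (hgk : ∀ y ∈ V, g (k y) = y) : DifferentiableOn ℂ k V := by
  intro c hc
  have hkc : ContinuousAt k c := hk.continuousAt (hV.mem_nhds hc)
  -- This avoids showing that `deriv g` has no zeros: critical points are isolated, so `k` is
  -- differentiable on a punctured neighbourhood of `c`, and continuity removes the singularity.
  refine (Complex.analyticAt_of_differentiable_on_punctured_nhds_of_continuousAt ?_
    hkc).differentiableAt.differentiableWithinAt
  have hcrit := eventually_nhdsWithin_iff.1
    (eventually_deriv_ne_zero_of_injOn hU (hkV hc) hg hinj)
  filter_upwards [nhdsWithin_le_nhds (hkc.eventually hcrit),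
    nhdsWithin_le_nhds (hV.mem_nhds hc), self_mem_nhdsWithin] with y hy hyV hyc
  have hne : k y ≠ k c := fun h ↦ hyc (by
    rw [mem_singleton_iff, ← hgk y hyV, h, hgk c hc])
  have hgy : HasDerivAt g (deriv g (k y)) (k y) :=
    (hg.differentiableAt (hU.mem_nhds (hkV hyV))).hasDerivAt
  exact (hgy.of_local_left_inverse (hk.continuousAt (hV.mem_nhds hyV)) (hy hne)
    (Filter.eventually_of_mem (hV.mem_nhds hyV) hgk)).differentiableAt

/-! ### Transport of Perron families -/

/-- Mutually inverse holomorphic maps between two open sets, with mutually inverse continuous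
extensions to the boundaries. -/
structure IsBoundaryBiholomorphism (g k : ℂ → ℂ) (U V : Set ℂ) : Prop where
  isOpen_left : IsOpen U
  isOpen_right : IsOpen V
  differentiableOn_left : DifferentiableOn ℂ g U
  differentiableOn_right : DifferentiableOn ℂ k V
  continuousOn_left : ContinuousOn g (closure U)
  continuousOn_right : ContinuousOn k (closure V)
  mapsTo_left : MapsTo g U V
  mapsTo_right : MapsTo k V U
  mapsTo_frontier_left : MapsTo g (frontier U) (frontier V)
  mapsTo_frontier_right : MapsTo k (frontier V) (frontier U)
  leftInvOn : LeftInvOn k g (closure U)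
  rightInvOn : RightInvOn k g (closure V)

namespace IsBoundaryBiholomorphism

variable {g k : ℂ → ℂ} {U V : Set ℂ}

theorem symm (H : IsBoundaryBiholomorphism g k U V) : IsBoundaryBiholomorphism k g V U :=
  ⟨H.isOpen_right, H.isOpen_left, H.differentiableOn_right, H.differentiableOn_left,
    H.continuousOn_right, H.continuousOn_left, H.mapsTo_right, H.mapsTo_left,
    H.mapsTo_frontier_right, H.mapsTo_frontier_left, H.rightInvOn, H.leftInvOn⟩

theorem image_eq_preimage (H : IsBoundaryBiholomorphism g k U V) {s : Set ℂ} (hs : s ⊆ U) :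
    g '' s = V ∩ k ⁻¹' s := by
  ext y
  constructor
  · rintro ⟨x, hx, rfl⟩
    refine ⟨H.mapsTo_left (hs hx), ?_⟩
    rwa [mem_preimage, H.leftInvOn (subset_closure (hs hx))]
  · rintro ⟨hy, hky⟩
    exact ⟨k y, hky, H.rightInvOn (subset_closure hy)⟩

theorem isOpen_image (H : IsBoundaryBiholomorphism g k U V) {s : Set ℂ} (hs : s ⊆ U)
    (hso : IsOpen s) : IsOpen (g '' s) := by
  rw [H.image_eq_preimage hs]
  exact (H.continuousOn_right.mono subset_closure).isOpen_inter_preimage H.isOpen_right hso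

theorem image_interior_subset (H : IsBoundaryBiholomorphism g k U V) {s : Set ℂ} (hs : s ⊆ U) :
    g '' interior s ⊆ interior (g '' s) :=
  interior_maximal (image_mono interior_subset)
    (H.isOpen_image (interior_subset.trans hs) isOpen_interior)

theorem image_subset (H : IsBoundaryBiholomorphism g k U V) {s : Set ℂ} (hs : s ⊆ U) :
    g '' s ⊆ V :=
  (image_mono hs).trans H.mapsTo_left.image_subset

theorem image_image (H : IsBoundaryBiholomorphism g k U V) {s : Set ℂ} (hs : s ⊆ U) :
    k '' (g '' s) = s :=
  (H.leftInvOn.mono (hs.trans subset_closure)).image_image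

theorem mapsTo_interior_image (H : IsBoundaryBiholomorphism g k U V) {s : Set ℂ} (hs : s ⊆ U) :
    MapsTo k (interior (g '' s)) (interior s) := by
  have h := H.symm.image_interior_subset (H.image_subset hs)
  rw [H.image_image hs] at h
  exact mapsTo_iff_image_subset.2 h

/-- Both sets are closed, so a frontier point is a non-interior point of the set, and `g` sends
interior points to interior points. -/
theorem mapsTo_frontier_image (H : IsBoundaryBiholomorphism g k U V) {s : Set ℂ} (hs : s ⊆ U)
    (hsc : IsCompact s) : MapsTo k (frontier (g '' s)) (frontier s) := by
  intro y hy
  have hc : IsCompact (g '' s) :=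
    hsc.image_of_continuousOn (H.continuousOn_left.mono (hs.trans subset_closure))
  rw [hc.isClosed.frontier_eq] at hy
  rw [hsc.isClosed.frontier_eq]
  obtain ⟨⟨x, hx, rfl⟩, hint⟩ := hy
  rw [H.leftInvOn (subset_closure (hs hx))]
  exact ⟨hx, fun hxi ↦ hint (H.image_interior_subset hs (mem_image_of_mem g hxi))⟩

/-- Subharmonicity is preserved by conformal changes of variable. -/
theorem isSubharmonicOn_comp (H : IsBoundaryBiholomorphism g k U V) {v : ℂ → ℝ}
    (hv : IsSubharmonicOn v V) : IsSubharmonicOn (v ∘ g) U where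
  upperSemicontinuousOn := fun x hx c hc ↦
    ((H.continuousOn_left.mono subset_closure x hx).tendsto_nhdsWithin H.mapsTo_left).eventually
      (hv.upperSemicontinuousOn (g x) (H.mapsTo_left hx) c hc)
  le_harmonic := by
    intro K hKU hK h hh hharm hle w hw
    have hkK : ∀ x ∈ K, k (g x) = x := fun x hx ↦ H.leftInvOn (subset_closure (hKU hx))
    have hKV : g '' K ⊆ V := H.image_subset hKU
    have hmaps : MapsTo k (g '' K) K := by
      rintro _ ⟨x, hx, rfl⟩
      rwa [hkK x hx]
    -- The test pair `(K, h)` for `v ∘ g` becomes the test pair `(g '' K, h ∘ k)` for `v`.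
    have key := hv.le_harmonic (g '' K) hKV
      (hK.image_of_continuousOn (H.continuousOn_left.mono (hKU.trans subset_closure))) (h ∘ k)
      (hh.comp (H.continuousOn_right.mono (hKV.trans subset_closure)) hmaps)
      (fun y hy ↦ harmonicAt_comp_analyticAt (hharm _ (H.mapsTo_interior_image hKU hy))
        (H.differentiableOn_right.analyticAt
          (H.isOpen_right.mem_nhds (hKV (interior_subset hy)))))
      (fun y hy ↦ by
        have hyf := H.mapsTo_frontier_image hKU hK hy
        have hyK : y ∈ g '' K :=
          (hK.image_of_continuousOn
            (H.continuousOn_left.mono (hKU.trans subset_closure))).isClosed.frontier_subset hy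
        simpa [H.rightInvOn (subset_closure (hKV hyK))] using hle (k y) hyf)
      (g w) (mem_image_of_mem g hw)
    simpa [hkK w hw] using key

/-- The Perron family pulls back under a conformal map that extends to the boundary. -/
theorem comp_mem_perronFamily (H : IsBoundaryBiholomorphism g k U V) {E F : Set ℂ}
    (hEF : ∀ ζ ∈ frontier U, g ζ ∈ F ↔ ζ ∈ E) {v : ℂ → ℝ} (hv : v ∈ perronFamily V F) :
    v ∘ g ∈ perronFamily U E := by
  refine ⟨H.isSubharmonicOn_comp hv.1, fun ζ hζ ε hε ↦ ?_⟩
  have hlim : Tendsto g (𝓝[U] ζ) (𝓝[V] (g ζ)) :=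
    ((H.continuousOn_left ζ (frontier_subset_closure hζ)).mono
      subset_closure).tendsto_nhdsWithin H.mapsTo_left
  have hind : F.indicator (fun _ ↦ (1 : ℝ)) (g ζ) = E.indicator (fun _ ↦ (1 : ℝ)) ζ := by
    by_cases h : ζ ∈ E
    · rw [indicator_of_mem h, indicator_of_mem ((hEF ζ hζ).2 h)]
    · rw [indicator_of_notMem h, indicator_of_notMem (mt (hEF ζ hζ).1 h)]
  rw [← hind]
  exact hlim.eventually (hv.2 (g ζ) (H.mapsTo_frontier_left hζ) ε hε)

/-- Conformal invariance of the harmonic measure. -/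
theorem harmonicMeasure_eq (H : IsBoundaryBiholomorphism g k U V) {E F : Set ℂ}
    (hEF : ∀ ζ ∈ frontier U, g ζ ∈ F ↔ ζ ∈ E) {z : ℂ} (hz : z ∈ U) :
    harmonicMeasure V F (g z) = harmonicMeasure U E z := by
  have hFE : ∀ ζ ∈ frontier V, k ζ ∈ E ↔ ζ ∈ F := fun ζ hζ ↦ by
    rw [← hEF _ (H.mapsTo_frontier_right hζ), H.rightInvOn (frontier_subset_closure hζ)]
  unfold harmonicMeasure
  -- The sets of values coincide, so `sSup` needs neither boundedness nor nonemptiness.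
  congr 1
  ext a
  constructor
  · rintro ⟨v, hv, rfl⟩
    exact ⟨v ∘ g, H.comp_mem_perronFamily hEF hv, rfl⟩
  · rintro ⟨v, hv, rfl⟩
    exact ⟨v ∘ k, H.symm.comp_mem_perronFamily hFE hv, by
      simp [H.leftInvOn (subset_closure hz)]⟩

end IsBoundaryBiholomorphism

/-! ### Inverse map and boundary correspondence -/

/-- An injective continuous map on a compact set has a continuous inverse. -/
theorem continuousOn_invFunOn_image {X Y : Type*} [Nonempty X] [TopologicalSpace X]
    [TopologicalSpace Y] [T2Space Y] {g : X → Y} {s : Set X} (hs : IsCompact s)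
    (hg : ContinuousOn g s) (hinj : InjOn g s) :
    ContinuousOn (Function.invFunOn g s) (g '' s) := by
  rw [continuousOn_iff_isClosed]
  intro t ht
  -- Compact in a Hausdorff space, hence closed.
  refine ⟨g '' (s ∩ t),
    ((hs.inter_right ht).image_of_continuousOn (hg.mono inter_subset_left)).isClosed, ?_⟩
  ext y
  constructor
  · rintro ⟨hyt, x, hx, rfl⟩
    rw [mem_preimage, hinj.leftInvOn_invFunOn hx] at hyt
    exact ⟨⟨x, ⟨hx, hyt⟩, rfl⟩, x, hx, rfl⟩
  · rintro ⟨⟨x, ⟨hx, hxt⟩, rfl⟩, hy⟩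
    refine ⟨?_, hy⟩
    rwa [mem_preimage, hinj.leftInvOn_invFunOn hx]

namespace BoundaryPartition

variable {Ω : Set ℂ} {n : ℕ}

theorem exists_curve_eq (P : BoundaryPartition Ω n) {ζ : ℂ} (hζ : ζ ∈ frontier Ω) :
    ∃ s ∈ Ico 0 (2 * Real.pi), P.curve s = ζ := by
  rw [← P.range_curve] at hζ
  obtain ⟨s, rfl⟩ := hζ
  obtain ⟨r, hr, h⟩ := P.periodic_curve.exists_mem_Ico₀ Real.two_pi_pos s
  exact ⟨r, hr, h.symm⟩

theorem segment_subset_frontier (P : BoundaryPartition Ω n) (j : Fin n) :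
    P.segment j ⊆ frontier Ω :=
  (image_subset_range _ _).trans P.range_curve.subset

end BoundaryPartition

section Transport

variable {C : ℂ → ℂ} {Ω₁ Ω₂ : Set ℂ} {n : ℕ} {P₁ : BoundaryPartition Ω₁ n}
  {P₂ : BoundaryPartition Ω₂ n}

theorem IsTransported.injOn_frontier (hP : IsTransported C P₁ P₂) : InjOn C (frontier Ω₁) := by
  intro ζ hζ ξ hξ h
  obtain ⟨s, hs, rfl⟩ := P₁.exists_curve_eq hζ
  obtain ⟨r, hr, rfl⟩ := P₁.exists_curve_eq hξ
  rw [← hP.curve_eq, ← hP.curve_eq] at h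
  rw [P₂.injOn_curve hs hr h]

theorem IsTransported.segment_eq (hP : IsTransported C P₁ P₂) (j : Fin n) :
    P₂.segment j = C '' P₁.segment j := by
  unfold BoundaryPartition.segment
  rw [hP.t_eq, Set.image_image]
  simp only [hP.curve_eq]

theorem IsTransported.mem_segment_iff (hP : IsTransported C P₁ P₂) (j : Fin n) {ζ : ℂ}
    (hζ : ζ ∈ frontier Ω₁) : C ζ ∈ P₂.segment j ↔ ζ ∈ P₁.segment j := by
  rw [hP.segment_eq]
  exact hP.injOn_frontier.mem_image_iff (P₁.segment_subset_frontier j) hζ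

/-- A conformal map that is injective on the boundary has an inverse of the same kind. -/
theorem IsConformalMap.isBoundaryBiholomorphism (hΩ₁ : IsDomain Ω₁) (hΩ₂ : IsDomain Ω₂)
    (hC : IsConformalMap C Ω₁ Ω₂) (hinj : InjOn C (frontier Ω₁)) :
    IsBoundaryBiholomorphism C (Function.invFunOn C (closure Ω₁)) Ω₁ Ω₂ := by
  have hcl₁ : closure Ω₁ = Ω₁ ∪ frontier Ω₁ := closure_eq_self_union_frontier Ω₁
  have himage : C '' closure Ω₁ = closure Ω₂ := by
    rw [hcl₁, image_union, hC.image_eq, hC.image_frontier, closure_eq_self_union_frontier]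
  have hdisj : Disjoint Ω₂ (frontier Ω₂) := by
    rw [disjoint_comm, hΩ₂.isOpen.frontier_eq]
    exact disjoint_sdiff_left
  have hmaps : MapsTo C Ω₁ Ω₂ := mapsTo_iff_image_subset.2 hC.image_eq.subset
  have hmapsF : MapsTo C (frontier Ω₁) (frontier Ω₂) :=
    mapsTo_iff_image_subset.2 hC.image_frontier.subset
  have hinjcl : InjOn C (closure Ω₁) := by
    rw [hcl₁]
    -- The mixed cases are impossible: the open set `Ω₂` misses its frontier.
    rintro a (ha | ha) b (hb | hb) h
    · exact hC.injOn ha hb h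
    · exact (hdisj.ne_of_mem (hmaps ha) (hmapsF hb) h).elim
    · exact (hdisj.ne_of_mem (hmaps hb) (hmapsF ha) h.symm).elim
    · exact hinj ha hb h
  have hleft : LeftInvOn (Function.invFunOn C (closure Ω₁)) C (closure Ω₁) :=
    hinjcl.leftInvOn_invFunOn
  have hright : RightInvOn (Function.invFunOn C (closure Ω₁)) C (closure Ω₂) := by
    intro y hy
    rw [← himage] at hy
    exact Function.invFunOn_eq hy
  have hcont : ContinuousOn (Function.invFunOn C (closure Ω₁)) (closure Ω₂) :=
    himage ▸ continuousOn_invFunOn_image hΩ₁.isBounded.isCompact_closure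
      hC.continuousOn_closure hinjcl
  have hmapsInv : MapsTo (Function.invFunOn C (closure Ω₁)) Ω₂ Ω₁ := by
    intro y hy
    rw [← hC.image_eq] at hy
    obtain ⟨x, hx, rfl⟩ := hy
    rwa [hleft (subset_closure hx)]
  refine ⟨hΩ₁.isOpen, hΩ₂.isOpen, hC.differentiableOn, ?_, hC.continuousOn_closure, hcont, hmaps,
    hmapsInv, hmapsF, ?_, hleft, hright⟩
  · exact differentiableOn_of_inverse hΩ₁.isOpen hΩ₂.isOpen hC.differentiableOn hC.injOn
      (hcont.mono subset_closure) hmapsInv fun y hy ↦ hright (subset_closure hy)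
  · intro y hy
    rw [← hC.image_frontier] at hy
    obtain ⟨x, hx, rfl⟩ := hy
    rwa [hleft (frontier_subset_closure hx)]

end Transport

end ReducedDivergence

theorem theorem4 {Ω₁ Ω₂ : Set ℂ}
    (hΩ₁ : ReducedDivergence.IsDomain Ω₁) (hΩ₂ : ReducedDivergence.IsDomain Ω₂)
    (C : ℂ → ℂ) (hC : ReducedDivergence.IsConformalMap C Ω₁ Ω₂)
    {n : ℕ} (P₁ : ReducedDivergence.BoundaryPartition Ω₁ n)
    (P₂ : ReducedDivergence.BoundaryPartition Ω₂ n)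
    (hP : ReducedDivergence.IsTransported C P₁ P₂)
    (f : ℝ → ℝ) (hf : StrictConvexOn ℝ (Set.Ioi 0) f) (hf1 : f 1 = 0)
    (x y : ℂ) (hx : x ∈ Ω₁) (hy : y ∈ Ω₁) :
    ReducedDivergence.reducedDivergence P₂ f (C x) (C y) =
      ReducedDivergence.reducedDivergence P₁ f x y := by
  have H := hC.isBoundaryBiholomorphism hΩ₁ hΩ₂ hP.injOn_frontier
  have hcoord : ∀ (j : Fin n) {z : ℂ}, z ∈ Ω₁ →
      ReducedDivergence.reducedCoord P₂ j (C z) = ReducedDivergence.reducedCoord P₁ j z :=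
    fun j _ hz ↦ H.harmonicMeasure_eq (fun _ hζ ↦ hP.mem_segment_iff j hζ) hz
  simp only [ReducedDivergence.reducedDivergence, hcoord _ hx, hcoord _ hy]
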